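/- Let $(X_j)_{j\ge 1}$ be pairwise uncorrelated zero-mean random processes on $[0,1]$, defined on one probability space, with finite second moments and with one and the same continuous covariance function $\mathcal K(t,s)=\mathrm{cov}(X_j(t),X_j(s))$, $t,s\in[0,1]$; uncorrelated means $\mathrm{cov}(X_j(t),X_k(s))=0$ for all $j\ne k$ and all $t,s\in[0,1]$. For $d\ge 1$ and $t=(t_1,\dots,t_d)\in[0,1]^d$ put $$Y_d(t)=\sum_{j=1}^d X_j(t_j),\qquad \widetilde J_d(t)=\sum_{j=1}^d\frac{\sum_{l=1}^d X_j(t_l)}{d},\qquad \widetilde Z_d(t)=\sum_{j=1}^d\Bigl(X_j(t_j)-\frac{\sum_{l=1}^d X_j(t_l)}{d}\Bigr),$$ so that $Y_d=\widetilde J_d+\widetilde Z_d$. For a random field $V$ on $[0,1]^d$ let $K^V$ be its covariance operator on $L_2([0,1]^d)$, $(K^Vf)(t)=\int_{[0,1]^d}\mathrm{cov}(V(t),V(s))f(s)\,ds$, let $(\lambda^V_k)_{k\in\mathbb N}$ be the non-increasing sequence of its eigenvalues, in which every non-zero eigenvalue is repeated according to its multiplicity (and $\lambda^V_k=0$ for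 $k>p$ if $K^V$ has finite rank $p$), and let $(\psi^V_k)$ be a corresponding sequence of eigenvectors, orthonormal over those $k$ with $\lambda^V_k\neq0$. Put $$\mathcal S(V)=\{(\lambda^V_k,\psi^V_k):\lambda^V_k\ne 0,\ k\in\mathbb N\};$$ this set depends on the choice of the eigenvectors. Then for every $d\ge 1$ and every choice of the eigenvectors of $K^{\widetilde J_d}$ and of $K^{\widetilde Z_d}$: 1) $\mathcal S(\widetilde J_d)\cap\mathcal S(\widetilde Z_d)=\varnothing$; 2) $\mathcal S(Y_d)=\mathcal S(\widetilde J_d)\cup\mathcal S(\widetilde Z_d)$ for a suitable choice of the eigenvectors of $K^{Y_d}$; that is, $\mathcal S(\widetilde J_d)\cup\mathcal S(\widetilde Z_d)$ is the set $\{(\lambda_k,\psi_k):\lambda_k\ne0\}$ formed from the non-increasing sequence of eigenvalues of $K^{Y_d}$, with multiplicity, and a corresponding orthonormal sequence of eigenvectors. -/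

import Mathlib

open MeasureTheory ProbabilityTheory

noncomputable section

/-- The additive random field `Y_d(t) = ∑_j X_j(t_j)`, `t ∈ [0,1]^d`. The summands are numbered from
`0`, so that `Y_d` uses `X 0, …, X (d - 1)`. -/
def fieldY {Ω : Type*} (X : ℕ → unitInterval → Ω → ℝ) (d : ℕ) :
    (Fin d → unitInterval) → Ω → ℝ :=
  fun t ω => ∑ j : Fin d, X j (t j) ω

/-- The symmetrised average part `J̃_d(t) = ∑_j (∑_l X_j(t_l)) / d`. -/
def fieldJ {Ω : Type*} (X : ℕ → unitInterval → Ω → ℝ) (d : ℕ) :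
    (Fin d → unitInterval) → Ω → ℝ :=
  fun t ω => ∑ j : Fin d, (∑ l : Fin d, X j (t l) ω) / (d : ℝ)

/-- The remaining part `Z̃_d(t) = ∑_j (X_j(t_j) - (∑_l X_j(t_l)) / d)`. -/
def fieldZ {Ω : Type*} (X : ℕ → unitInterval → Ω → ℝ) (d : ℕ) :
    (Fin d → unitInterval) → Ω → ℝ :=
  fun t ω => ∑ j : Fin d, (X j (t j) ω - (∑ l : Fin d, X j (t l) ω) / (d : ℝ))

/-- The space `L_2([0,1]^d)` with respect to Lebesgue measure. -/
abbrev L2Cube (d : ℕ) : Type :=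
  Lp ℝ 2 (volume : Measure (Fin d → unitInterval))

/-- The covariance function `𝒦^V(t,s) = cov(V(t), V(s))` of a random field `V`. -/
def covFun {Ω T : Type*} [MeasurableSpace Ω] (P : Measure Ω) (V : T → Ω → ℝ) (t s : T) : ℝ :=
  cov[V t, V s; P]

/-- The covariance operator of a random field on `[0,1]^d`: the integral operator
`(K^V f)(t) = ∫ 𝒦^V(t,s) f(s) ds`. -/
def covOp {Ω : Type*} [MeasurableSpace Ω] (P : Measure Ω) {d : ℕ}
    (V : (Fin d → unitInterval) → Ω → ℝ) (f : (Fin d → unitInterval) → ℝ) :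
    (Fin d → unitInterval) → ℝ :=
  fun t => ∫ s, covFun P V t s * f s

/-- `K^V f = μ f` as an identity in `L_2([0,1]^d)`. -/
def EigenEq {Ω : Type*} [MeasurableSpace Ω] (P : Measure Ω) {d : ℕ}
    (V : (Fin d → unitInterval) → Ω → ℝ) (μ : ℝ) (f : L2Cube d) : Prop :=
  covOp P V f =ᵐ[volume] fun t => μ * f t

/-- `lam` is the non-increasing sequence of eigenvalues of `K^V` and `ψ` a corresponding sequence of
orthonormal eigenvectors: every non-zero eigenvalue is listed with its multiplicity, and `lam` is
continued by zeros if `K^V` has finite rank. Nothing is asked of `ψ k` when `lam k = 0`. -/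
structure IsEigenSequence {Ω : Type*} [MeasurableSpace Ω] (P : Measure Ω) {d : ℕ}
    (V : (Fin d → unitInterval) → Ω → ℝ) (lam : ℕ → ℝ) (ψ : ℕ → L2Cube d) : Prop where
  antitone : Antitone lam
  eigen : ∀ k, lam k ≠ 0 → EigenEq P V (lam k) (ψ k)
  orthonormal : Orthonormal ℝ (fun k : {k : ℕ // lam k ≠ 0} => ψ k)
  complete : ∀ (μ : ℝ) (f : L2Cube d), μ ≠ 0 → EigenEq P V μ f →
    f ∈ Submodule.span ℝ (ψ '' {k | lam k = μ})

/-- `S` is a set `𝒮(V) = {(λ_k, ψ_k) : λ_k ≠ 0, k ∈ ℕ}` of eigenpairs of the covariance operator of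
`V`, for some choice of the orthonormal eigenvectors `ψ_k`. -/
def IsEigenpairSet {Ω : Type*} [MeasurableSpace Ω] (P : Measure Ω) {d : ℕ}
    (V : (Fin d → unitInterval) → Ω → ℝ) (S : Set (ℝ × L2Cube d)) : Prop :=
  ∃ (lam : ℕ → ℝ) (ψ : ℕ → L2Cube d), IsEigenSequence P V lam ψ ∧
    S = {p | ∃ k, lam k ≠ 0 ∧ p = (lam k, ψ k)}

end

/-!
The variable `J̃_d(s)` has the same covariance with each of `X_1(r), …, X_d(r)`, and deviations
from an average sum to zero; hence `J̃_d` and `Z̃_d` are uncorrelated and `K^Y = K^J + K^Z`. The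
kernel of `K^J` is symmetric under permutations of the coordinates and the kernel of `K^Z` is a sum
of terms `f(u_j) - (∑ l, f(u_l)) / d`, so `K^J K^Z = 0`. For symmetric operators `A`, `B` with
`A B = 0`, the eigenvectors of each one to non-zero eigenvalues are annihilated by the other, so
eigenpairs of `A` and of `B` are disjoint and together form a system of eigenpairs of `A + B`. By
Bessel's inequality the eigenvalues of an integral operator are square summable, which is what
allows the union to be listed in non-increasing order.
-/

section Rearrangement

theorem nonempty_initialSeg_nat_of_finite_Iio {α : Type*} [LinearOrder α]
    (h : ∀ a : α, (Set.Iio a).Finite) : Nonempty (α ≤i ℕ) := by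
  have : WellFoundedLT α :=
    StrictMono.wellFoundedLT (f := fun a : α => (Set.Iio a).ncard) fun _ b hab =>
      Set.ncard_lt_ncard (Set.Iio_ssubset_Iio hab) (h b)
  rcases InitialSeg.total (α := α) (β := ℕ) (· < ·) (· < ·) with f | g
  · exact ⟨f⟩
  rcases g.principalSumRelIso with g | g
  · exact absurd ((h g.top).subset (Set.range_subset_iff.2 g.lt_top))
      (Set.infinite_range_of_injective g.injective)
  · exact ⟨g.symm.toInitialSeg⟩

theorem exists_injective_isLowerSet_range_of_finite_le {ι β : Type*} [LinearOrder β] (v : ι → β)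
    (hfin : ∀ i, {j | v i ≤ v j}.Finite) :
    ∃ e : ι → ℕ, Function.Injective e ∧ IsLowerSet (Set.range e) ∧
      ∀ i j, e i ≤ e j → v j ≤ v i := by
  obtain ⟨_, -⟩ := exists_wellFoundedLT ι
  -- Ties between equal values are broken by an arbitrary well-order of `ι`.
  let key : ι → βᵒᵈ ×ₗ ι := fun i => toLex (OrderDual.toDual (v i), i)
  have key_inj : Function.Injective key := fun i j h => congrArg Prod.snd (toLex.injective h)
  have le_of_key_le {i j : ι} (h : key i ≤ key j) : v j ≤ v i := Prod.Lex.monotone_fst _ _ h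
  let k := Equiv.ofInjective key key_inj
  have finite_Iio : ∀ a : Set.range key, (Set.Iio a).Finite := by
    rintro ⟨_, i, rfl⟩
    refine ((hfin i).image k).subset ?_
    rintro ⟨_, j, rfl⟩ hj
    exact ⟨j, le_of_key_le (le_of_lt hj), rfl⟩
  obtain ⟨f⟩ := nonempty_initialSeg_nat_of_finite_Iio finite_Iio
  refine ⟨f ∘ k, f.injective.comp k.injective, ?_, fun i j h => le_of_key_le (f.le_iff_le.1 h)⟩
  rw [k.surjective.range_comp]
  exact f.isLowerSet_range

theorem antitone_extend_zero {ι : Type*} {v : ι → ℝ} (hv : ∀ i, 0 ≤ v i) {e : ι → ℕ}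
    (he : Function.Injective e) (hrange : IsLowerSet (Set.range e))
    (hanti : ∀ i j, e i ≤ e j → v j ≤ v i) : Antitone (Function.extend e v 0) := by
  intro k m hkm
  by_cases hm : m ∈ Set.range e
  · obtain ⟨i, rfl⟩ := hrange hkm hm
    obtain ⟨j, rfl⟩ := hm
    simpa only [he.extend_apply] using hanti i j hkm
  · rw [Function.extend_apply' _ _ _ hm]
    exact Function.extend_nonneg hv le_rfl k

theorem exists_antitone_bijOn {E : Type*} [Nonempty E] {S : Set (ℝ × E)} (hpos : ∀ p ∈ S, 0 < p.1)
    (hfin : ∀ ε > 0, {p : S | ε ≤ p.1.1}.Finite) :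
    ∃ (lam : ℕ → ℝ) (ψ : ℕ → E), Antitone lam ∧
      Set.BijOn (fun k => (lam k, ψ k)) {k | lam k ≠ 0} S := by
  obtain ⟨e, e_inj, e_lower, e_anti⟩ := exists_injective_isLowerSet_range_of_finite_le
    (fun p : S => p.1.1) fun p => hfin _ (hpos _ p.2)
  let lam := Function.extend e (fun p : S => p.1.1) 0
  let ψ := Function.extend e (fun p : S => p.1.2) fun _ => Classical.arbitrary E
  have pair_e (p : S) : (lam (e p), ψ (e p)) = p := by
    simp only [lam, ψ, e_inj.extend_apply]
  have support_eq : {k | lam k ≠ 0} = Set.range e := by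
    ext k
    refine ⟨fun hk => by_contra fun h => hk (Function.extend_apply' _ _ _ h), ?_⟩
    rintro ⟨p, rfl⟩
    exact (e_inj.extend_apply _ _ p).trans_ne (hpos _ p.2).ne'
  refine ⟨lam, ψ, antitone_extend_zero (fun p => (hpos _ p.2).le) e_inj e_lower e_anti, ?_⟩
  rw [support_eq]
  refine ⟨?_, ?_, fun p hp => ⟨e ⟨p, hp⟩, ⟨_, rfl⟩, pair_e ⟨p, hp⟩⟩⟩
  · rintro _ ⟨p, rfl⟩
    simp only [pair_e, Subtype.coe_prop]
  · rintro _ ⟨p, rfl⟩ _ ⟨q, rfl⟩ hpq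
    simp only [pair_e] at hpq
    rw [Subtype.ext hpq]

end Rearrangement

section Eigensystem

variable {𝕜 H : Type*} [RCLike 𝕜] [NormedAddCommGroup H] [InnerProductSpace 𝕜 H]

/-- A set of pairs (non-zero eigenvalue, eigenvector) of `A` whose eigenvectors are orthonormal and
span every eigenspace of `A` to a non-zero eigenvalue: the set `𝒮` of eigenpairs without an
enumeration. Multiplicity is encoded by the number of pairs with the same first component. -/
structure IsEigensystem (A : Module.End 𝕜 H) (S : Set (𝕜 × H)) : Prop where
  ne_zero : ∀ p ∈ S, p.1 ≠ 0
  apply_eq : ∀ p ∈ S, A p.2 = p.1 • p.2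
  orthonormal : Orthonormal 𝕜 fun p : S => p.1.2
  eigenspace_le_span : ∀ μ ≠ 0, A.eigenspace μ ≤ Submodule.span 𝕜 {f | (μ, f) ∈ S}

variable {A B : Module.End 𝕜 H}

theorem mul_eq_zero_comm_of_isSymmetric (hA : A.IsSymmetric) (hB : B.IsSymmetric)
    (hAB : A * B = 0) : B * A = 0 := by
  ext f
  refine ext_inner_right 𝕜 fun g => ?_
  have := LinearMap.congr_fun hAB g
  rw [Module.End.mul_apply, hB, hA, ← Module.End.mul_apply, hAB]
  simp

namespace IsEigensystem

variable {S T : Set (𝕜 × H)}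

theorem apply_eq_zero_of_mul_eq_zero (hS : IsEigensystem A S) (hBA : B * A = 0) {p : 𝕜 × H}
    (hp : p ∈ S) : B p.2 = 0 := by
  have h : B (A p.2) = 0 := LinearMap.congr_fun hBA p.2
  rw [hS.apply_eq p hp, map_smul] at h
  exact (smul_eq_zero.1 h).resolve_left (hS.ne_zero p hp)

theorem inner_eq_zero_of_mul_eq_zero (hA : A.IsSymmetric) (hAB : A * B = 0)
    (hS : IsEigensystem A S) (hT : IsEigensystem B T) {p q : 𝕜 × H} (hp : p ∈ S) (hq : q ∈ T) :
    inner 𝕜 q.2 p.2 = 0 := by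
  have h := hA q.2 p.2
  rw [hT.apply_eq_zero_of_mul_eq_zero hAB hq, hS.apply_eq p hp, inner_zero_left,
    inner_smul_right] at h
  exact (mul_eq_zero.1 h.symm).resolve_left (hS.ne_zero p hp)

theorem disjoint_of_mul_eq_zero (hAB : A * B = 0) (hS : IsEigensystem A S)
    (hT : IsEigensystem B T) : Disjoint S T := by
  refine Set.disjoint_left.2 fun p hpS hpT => ?_
  have h := hT.apply_eq_zero_of_mul_eq_zero hAB hpT
  rw [hS.apply_eq p hpS] at h
  exact smul_ne_zero (hS.ne_zero p hpS) (hS.orthonormal.ne_zero ⟨p, hpS⟩) h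

theorem orthonormal_union (hA : A.IsSymmetric) (hAB : A * B = 0)
    (hS : IsEigensystem A S) (hT : IsEigensystem B T) :
    Orthonormal 𝕜 fun p : ↥(S ∪ T) => p.1.2 := by
  refine ⟨?_, ?_⟩
  · rintro ⟨p, hp | hp⟩
    · exact hS.orthonormal.1 ⟨p, hp⟩
    · exact hT.orthonormal.1 ⟨p, hp⟩
  · rintro ⟨p, hp | hp⟩ ⟨q, hq | hq⟩ hpq
    · exact hS.orthonormal.2 (i := ⟨p, hp⟩) (j := ⟨q, hq⟩) fun h =>
        hpq (Subtype.ext (Subtype.mk.inj h))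
    · exact inner_eq_zero_symm.1 (inner_eq_zero_of_mul_eq_zero hA hAB hS hT hp hq)
    · exact inner_eq_zero_of_mul_eq_zero hA hAB hS hT hq hp
    · exact hT.orthonormal.2 (i := ⟨p, hp⟩) (j := ⟨q, hq⟩) fun h =>
        hpq (Subtype.ext (Subtype.mk.inj h))

theorem union (hA : A.IsSymmetric) (hB : B.IsSymmetric) (hAB : A * B = 0)
    (hS : IsEigensystem A S) (hT : IsEigensystem B T) : IsEigensystem (A + B) (S ∪ T) where
  ne_zero p := Or.rec (hS.ne_zero p) (hT.ne_zero p)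
  apply_eq p hp := by
    have hBA := mul_eq_zero_comm_of_isSymmetric hA hB hAB
    rcases hp with hp | hp
    · rw [LinearMap.add_apply, hS.apply_eq p hp, hS.apply_eq_zero_of_mul_eq_zero hBA hp, add_zero]
    · rw [LinearMap.add_apply, hT.apply_eq p hp, hT.apply_eq_zero_of_mul_eq_zero hAB hp, zero_add]
  orthonormal := orthonormal_union hA hAB hS hT
  eigenspace_le_span μ hμ f hf := by
    have hBA := mul_eq_zero_comm_of_isSymmetric hA hB hAB
    have hf : A f + B f = μ • f := Module.End.mem_eigenspace_iff.1 hf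
    have hAf : A f ∈ A.eigenspace μ := Module.End.mem_eigenspace_iff.2 <| by
      rw [← map_smul, ← hf, map_add, ← Module.End.mul_apply A B, hAB, LinearMap.zero_apply,
        add_zero]
    have hBf : B f ∈ B.eigenspace μ := Module.End.mem_eigenspace_iff.2 <| by
      rw [← map_smul, ← hf, map_add, ← Module.End.mul_apply B A, hBA, LinearMap.zero_apply,
        zero_add]
    rw [← inv_smul_smul₀ hμ f, ← hf]
    refine Submodule.smul_mem _ _ (Submodule.add_mem _ ?_ ?_)
    · exact Submodule.span_mono (fun _ => Or.inl) (hS.eigenspace_le_span μ hμ hAf)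
    · exact Submodule.span_mono (fun _ => Or.inr) (hT.eigenspace_le_span μ hμ hBf)

end IsEigensystem

end Eigensystem

section KernelOperator

theorem tendsto_cofinite_of_summable_sq {ι : Type*} {lam : ι → ℝ}
    (h : Summable fun i => lam i ^ 2) : Filter.Tendsto lam Filter.cofinite (nhds 0) := by
  rw [tendsto_zero_iff_abs_tendsto_zero]
  simpa only [Real.sqrt_sq_eq_abs, Real.sqrt_zero, Function.comp_def] using
    h.tendsto_cofinite_zero.sqrt

theorem integrable_of_continuous_of_compactSpace {T E : Type*} [TopologicalSpace T]
    [CompactSpace T] [MeasurableSpace T] [OpensMeasurableSpace T] [NormedAddCommGroup E]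
    {μ : Measure T} [IsFiniteMeasureOnCompacts μ] {g : T → E} (hg : Continuous g) :
    Integrable g μ :=
  hg.integrable_of_hasCompactSupport (.of_compactSpace g)

variable {T : Type*} [TopologicalSpace T] [CompactSpace T] [MeasurableSpace T] [BorelSpace T]
  {μ : Measure T} [IsFiniteMeasure μ]

/-- The function `K(t, ·)` of a continuous kernel `K`, as an element of `L²`. Pairing with it gives
every value of the integral operator with kernel `K`, not only almost every one. -/
noncomputable def kernelRow (μ : Measure T) [IsFiniteMeasure μ] (K : C(T × T, ℝ)) (t : T) :
    Lp ℝ 2 μ :=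
  ContinuousMap.toLp 2 μ ℝ (K.curry t)

theorem continuous_kernelRow (K : C(T × T, ℝ)) : Continuous (kernelRow μ K) := by
  unfold kernelRow
  fun_prop

/-- The integral operator `(K f)(t) = ∫ K(t, s) f(s) ds` on `L²` of a continuous kernel on a compact
space. -/
noncomputable def kernelOp (μ : Measure T) [IsFiniteMeasure μ] (K : C(T × T, ℝ)) :
    Module.End ℝ (Lp ℝ 2 μ) where
  toFun f := ContinuousMap.toLp 2 μ ℝ
    ⟨fun t => inner ℝ (kernelRow μ K t) f, (continuous_kernelRow K).inner continuous_const⟩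
  map_add' f g := by
    rw [← map_add]
    congr 1
    ext t
    simp [inner_add_right]
  map_smul' c f := by
    rw [RingHom.id_apply, ← map_smul]
    congr 1
    ext t
    simp [inner_smul_right]

variable (K : C(T × T, ℝ))

theorem inner_kernelRow (t : T) (f : Lp ℝ 2 μ) :
    inner ℝ (kernelRow μ K t) f = ∫ s, K (t, s) * f s ∂μ := by
  rw [L2.inner_def]
  refine integral_congr_ae ?_
  filter_upwards [ContinuousMap.coeFn_toLp (p := 2) (𝕜 := ℝ) μ (K.curry t)] with s hs
  rw [kernelRow, hs, Real.inner_apply, ContinuousMap.curry_apply]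

theorem kernelOp_ae_eq_inner (f : Lp ℝ 2 μ) :
    kernelOp μ K f =ᵐ[μ] fun t => inner ℝ (kernelRow μ K t) f :=
  ContinuousMap.coeFn_toLp μ _

theorem kernelOp_ae_eq_integral (f : Lp ℝ 2 μ) :
    kernelOp μ K f =ᵐ[μ] fun t => ∫ s, K (t, s) * f s ∂μ := by
  simpa only [inner_kernelRow] using kernelOp_ae_eq_inner K f

theorem kernelOp_add (L : C(T × T, ℝ)) : kernelOp μ (K + L) = kernelOp μ K + kernelOp μ L := by
  ext1 f
  change ContinuousMap.toLp 2 μ ℝ _ = ContinuousMap.toLp 2 μ ℝ _ + ContinuousMap.toLp 2 μ ℝ _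
  rw [← map_add]
  congr 1
  ext t
  simp [kernelRow, ← inner_add_left, ← map_add]

theorem norm_kernelOp_sq (f : Lp ℝ 2 μ) :
    ‖kernelOp μ K f‖ ^ 2 = ∫ t, inner ℝ (kernelRow μ K t) f ^ 2 ∂μ := by
  rw [← real_inner_self_eq_norm_sq, L2.inner_def]
  refine integral_congr_ae ?_
  filter_upwards [kernelOp_ae_eq_inner K f] with t ht
  rw [ht, Real.inner_apply, sq]

section SquareSummability

variable {K} {ι : Type*} {lam : ι → ℝ} {ψ : ι → Lp ℝ 2 μ} (hψ : Orthonormal ℝ ψ)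
  (h : ∀ i, kernelOp μ K (ψ i) = lam i • ψ i)
include hψ h

theorem sum_sq_eigenvalue_le (F : Finset ι) :
    ∑ i ∈ F, lam i ^ 2 ≤ ∫ t, ‖kernelRow μ K t‖ ^ 2 ∂μ := by
  have hrow := continuous_kernelRow (μ := μ) K
  have hint_inner (i : ι) : Integrable (fun t => inner ℝ (kernelRow μ K t) (ψ i) ^ 2) μ :=
    integrable_of_continuous_of_compactSpace (by fun_prop)
  calc ∑ i ∈ F, lam i ^ 2
      = ∑ i ∈ F, ∫ t, inner ℝ (kernelRow μ K t) (ψ i) ^ 2 ∂μ := by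
        refine Finset.sum_congr rfl fun i _ => ?_
        rw [← norm_kernelOp_sq, h, norm_smul, hψ.1, mul_one, Real.norm_eq_abs, sq_abs]
    _ = ∫ t, ∑ i ∈ F, inner ℝ (kernelRow μ K t) (ψ i) ^ 2 ∂μ :=
        (integral_finsetSum F fun i _ => hint_inner i).symm
    _ ≤ ∫ t, ‖kernelRow μ K t‖ ^ 2 ∂μ := by
        refine integral_mono (integrable_finsetSum F fun i _ => hint_inner i)
          (integrable_of_continuous_of_compactSpace (by fun_prop)) fun t => ?_
        simpa only [real_inner_comm, Real.norm_eq_abs, sq_abs] using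
          hψ.sum_inner_products_le (kernelRow μ K t) (s := F)

theorem summable_sq_eigenvalue : Summable fun i => lam i ^ 2 :=
  summable_of_sum_le (fun _ => sq_nonneg _) (sum_sq_eigenvalue_le hψ h)

end SquareSummability

variable {K} [SecondCountableTopology T]

theorem isSymmetric_kernelOp (hK : ∀ t s, K (t, s) = K (s, t)) : (kernelOp μ K).IsSymmetric := by
  have inner_kernelOp (f g : Lp ℝ 2 μ) :
      inner ℝ (kernelOp μ K f) g = ∫ t, ∫ s, K (t, s) * (f s * g t) ∂μ ∂μ := by
    rw [L2.inner_def]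
    refine integral_congr_ae ?_
    filter_upwards [kernelOp_ae_eq_integral K f] with t ht
    simp only [ht, Real.inner_apply, ← mul_assoc, integral_mul_const]
  intro f g
  have hint : Integrable (fun p : T × T => K (p.1, p.2) * (f p.2 * g p.1)) (μ.prod μ) := by
    have hf : Integrable f μ := (Lp.memLp f).integrable one_le_two
    have hg : Integrable g μ := (Lp.memLp g).integrable one_le_two
    simpa only [mul_comm (g _)] using (hg.mul_prod hf).bdd_mul (c := ‖K‖)
      K.continuous.aestronglyMeasurable (.of_forall K.norm_coe_le_norm)
  calc inner ℝ (kernelOp μ K f) g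
      = ∫ t, ∫ s, K (t, s) * (f s * g t) ∂μ ∂μ := inner_kernelOp f g
    _ = ∫ s, ∫ t, K (t, s) * (f s * g t) ∂μ ∂μ := integral_integral_swap hint
    _ = ∫ s, ∫ t, K (s, t) * (g t * f s) ∂μ ∂μ := by simp only [hK _, mul_comm]
    _ = inner ℝ f (kernelOp μ K g) := by rw [real_inner_comm, inner_kernelOp]

theorem kernelOp_mul_eq_zero {L : C(T × T, ℝ)} (hL : ∀ t s, L (t, s) = L (s, t))
    (h : ∀ s t, ∫ u, L (s, u) * K (t, u) ∂μ = 0) : kernelOp μ K * kernelOp μ L = 0 := by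
  have kernelOp_row (t : T) : kernelOp μ L (kernelRow μ K t) = 0 := by
    rw [Lp.eq_zero_iff_ae_eq_zero]
    filter_upwards [kernelOp_ae_eq_inner L (kernelRow μ K t)] with s hs
    rw [hs, Pi.zero_apply, real_inner_comm, inner_kernelRow, ← h s t]
    refine integral_congr_ae ?_
    filter_upwards [ContinuousMap.coeFn_toLp (p := 2) (𝕜 := ℝ) μ (L.curry s)] with u hu
    rw [kernelRow, hu, ContinuousMap.curry_apply, mul_comm]
  ext1 f
  rw [Module.End.mul_apply, LinearMap.zero_apply, Lp.eq_zero_iff_ae_eq_zero]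
  filter_upwards [kernelOp_ae_eq_inner K (kernelOp μ L f)] with t ht
  rw [ht, ← isSymmetric_kernelOp hL, kernelOp_row, inner_zero_left, Pi.zero_apply]

end KernelOperator

section Exchangeability

variable {ι T : Type*} [Fintype ι] [MeasureSpace T] [SigmaFinite (volume : Measure T)]

theorem integral_comp_perm {E : Type*} [NormedAddCommGroup E] [NormedSpace ℝ E]
    (σ : Equiv.Perm ι) (g : (ι → T) → E) : ∫ u, g (u ∘ σ) = ∫ u, g u :=
  (volume_preserving_arrowCongr' σ.symm (MeasurableEquiv.refl T) (.id _)).integral_comp' g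

variable {f : T → ℝ} {h : (ι → T) → ℝ}

theorem integral_eval_mul_eq_of_symmetric (hh : ∀ (σ : Equiv.Perm ι) u, h (u ∘ σ) = h u)
    (i j : ι) : ∫ u, f (u i) * h u = ∫ u, f (u j) * h u := by
  classical
  rw [← integral_comp_perm (Equiv.swap i j)]
  simp only [hh, Function.comp_apply, Equiv.swap_apply_left]

theorem integral_eval_sub_average_mul_eq_zero_of_symmetric
    (hh : ∀ (σ : Equiv.Perm ι) u, h (u ∘ σ) = h u)
    (hint : ∀ i, Integrable fun u => f (u i) * h u) (i : ι) :
    ∫ u, (f (u i) - (∑ j, f (u j)) / Fintype.card ι) * h u = 0 := by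
  have : Nonempty ι := ⟨i⟩
  simp only [sub_mul, div_mul_eq_mul_div, Finset.sum_mul]
  rw [integral_sub (hint i) ((integrable_finsetSum _ fun j _ => hint j).div_const _),
    integral_div, integral_finsetSum _ fun j _ => hint j]
  simp only [integral_eval_mul_eq_of_symmetric hh _ i, Finset.sum_const, Finset.card_univ,
    nsmul_eq_mul]
  rw [mul_div_cancel_left₀ _ (by positivity), sub_self]

end Exchangeability

section CovarianceOperator

variable {Ω : Type*} [MeasurableSpace Ω] {P : Measure Ω} {d : ℕ}
  {V : (Fin d → unitInterval) → Ω → ℝ}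

/-- The covariance operator of a random field with continuous covariance function, as an
endomorphism of `L²([0,1]^d)`. -/
noncomputable def covEnd (hV : Continuous (Function.uncurry (covFun P V))) :
    Module.End ℝ (L2Cube d) :=
  kernelOp volume ⟨_, hV⟩

variable (hV : Continuous (Function.uncurry (covFun P V)))

theorem isSymmetric_covEnd : (covEnd hV).IsSymmetric :=
  isSymmetric_kernelOp fun _ _ => covariance_comm _ _

theorem eigenEq_iff_covEnd (μ : ℝ) (f : L2Cube d) : EigenEq P V μ f ↔ covEnd hV f = μ • f := by
  have hsmul : (μ • f : L2Cube d) =ᵐ[volume] fun t => μ * f t := Lp.coeFn_smul μ f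
  have hcov : covEnd hV f =ᵐ[volume] covOp P V f := kernelOp_ae_eq_integral _ f
  rw [EigenEq, Lp.ext_iff, hcov.congr_left, hsmul.congr_right]

variable {lam : ℕ → ℝ} {ψ : ℕ → L2Cube d} {S : Set (ℝ × L2Cube d)}

include hV in
theorem IsEigenSequence.tendsto_zero (h : IsEigenSequence P V lam ψ) :
    Filter.Tendsto lam Filter.atTop (nhds 0) := by
  have hsum : Summable fun k : {k // lam k ≠ 0} => lam k ^ 2 :=
    summable_sq_eigenvalue h.orthonormal fun k => (eigenEq_iff_covEnd hV _ _).1 (h.eigen k k.2)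
  rw [← Nat.cofinite_eq_atTop]
  refine tendsto_cofinite_of_summable_sq ((Subtype.val_injective.summable_iff ?_).1 hsum)
  intro k hk
  by_contra h0
  exact hk ⟨⟨k, fun h => h0 (by simp [h])⟩, rfl⟩

theorem IsEigenSequence.isEigensystem (h : IsEigenSequence P V lam ψ) :
    IsEigensystem (covEnd hV) ((fun k => (lam k, ψ k)) '' {k | lam k ≠ 0}) := by
  refine ⟨?_, ?_, ?_, fun μ hμ f hf => ?_⟩
  · rintro _ ⟨k, hk, rfl⟩
    exact hk
  · rintro _ ⟨k, hk, rfl⟩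
    exact (eigenEq_iff_covEnd hV _ _).1 (h.eigen k hk)
  · rw [Set.image_eq_range]
    set φ := fun k : {k | lam k ≠ 0} => (lam k, ψ k)
    convert h.orthonormal.comp _ (Set.rangeSplitting_injective φ) with p
    exact (congrArg Prod.snd (Set.apply_rangeSplitting φ p)).symm
  · have hf := (eigenEq_iff_covEnd hV _ _).2 (Module.End.mem_eigenspace_iff.1 hf)
    refine Submodule.span_mono ?_ (h.complete μ f hμ hf)
    rintro _ ⟨k, rfl, rfl⟩
    exact ⟨k, hμ, rfl⟩

theorem IsEigensystem.finite_le_fst (h : IsEigensystem (covEnd hV) S) {ε : ℝ} (hε : 0 < ε) :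
    {p : S | ε ≤ p.1.1}.Finite := by
  have htendsto := tendsto_cofinite_of_summable_sq <|
    summable_sq_eigenvalue h.orthonormal fun p => h.apply_eq p p.2
  simpa only [not_lt] using Filter.eventually_cofinite.1 (htendsto.eventually_lt_const hε)

theorem IsEigensystem.isEigenSequence (h : IsEigensystem (covEnd hV) S) (hanti : Antitone lam)
    (hS : Set.BijOn (fun k => (lam k, ψ k)) {k | lam k ≠ 0} S) : IsEigenSequence P V lam ψ where
  antitone := hanti
  eigen k hk := (eigenEq_iff_covEnd hV _ _).2 (h.apply_eq _ (hS.mapsTo hk))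
  orthonormal :=
    h.orthonormal.comp (fun k : {k // lam k ≠ 0} => ⟨(lam k, ψ k), hS.mapsTo k.2⟩)
      fun k l hkl => Subtype.ext (hS.injOn k.2 l.2 (congrArg Subtype.val hkl))
  complete μ f hμ hf := by
    have hf := h.eigenspace_le_span μ hμ
      (Module.End.mem_eigenspace_iff.2 ((eigenEq_iff_covEnd hV _ _).1 hf))
    refine Submodule.span_mono (fun g hg => ?_) hf
    obtain ⟨k, -, hk⟩ := hS.surjOn (show (μ, g) ∈ S from hg)
    exact ⟨k, congrArg Prod.fst hk, congrArg Prod.snd hk⟩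

theorem isEigenpairSet_iff :
    IsEigenpairSet P V S ↔ IsEigensystem (covEnd hV) S ∧ ∀ p ∈ S, 0 < p.1 := by
  have setOf_eq_image (lam : ℕ → ℝ) (ψ : ℕ → L2Cube d) :
      {p | ∃ k, lam k ≠ 0 ∧ p = (lam k, ψ k)} = (fun k => (lam k, ψ k)) '' {k | lam k ≠ 0} := by
    simp only [Set.image, Set.mem_ofPred_eq, eq_comm]
  constructor
  · rintro ⟨lam, ψ, h, rfl⟩
    rw [setOf_eq_image]
    refine ⟨h.isEigensystem hV, ?_⟩
    rintro _ ⟨k, hk, rfl⟩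
    exact (h.antitone.le_of_tendsto (h.tendsto_zero hV) k).lt_of_ne' hk
  · rintro ⟨h, hpos⟩
    obtain ⟨lam, ψ, hanti, hbij⟩ := exists_antitone_bijOn hpos fun ε => h.finite_le_fst hV
    exact ⟨lam, ψ, h.isEigenSequence hV hanti hbij,
      hbij.image_eq.symm.trans (setOf_eq_image lam ψ).symm⟩

end CovarianceOperator

section Fields

variable {Ω : Type*} {X : ℕ → unitInterval → Ω → ℝ} {d : ℕ}

theorem fieldY_eq_fieldJ_add_fieldZ : fieldY X d = fieldJ X d + fieldZ X d := by
  ext t ω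
  simp [fieldY, fieldJ, fieldZ]

section MemLp

variable [MeasurableSpace Ω] {P : Measure Ω} {p : ENNReal}
  (hX : ∀ j t, MemLp (X j t) p P) (t : Fin d → unitInterval)
include hX

theorem memLp_fieldY : MemLp (fieldY X d t) p P :=
  memLp_finsetSum _ fun j _ => hX j (t j)

theorem memLp_average (j : ℕ) : MemLp (fun ω => (∑ l, X j (t l) ω) / (d : ℝ)) p P := by
  simp only [div_eq_mul_inv]
  exact (memLp_finsetSum _ fun l _ => hX j (t l)).mul_const _

theorem memLp_sub_average (j : ℕ) (s : unitInterval) :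
    MemLp (fun ω => X j s ω - (∑ l, X j (t l) ω) / (d : ℝ)) p P :=
  (hX j s).sub (memLp_average hX t j)

theorem memLp_fieldJ : MemLp (fieldJ X d t) p P :=
  memLp_finsetSum _ fun j _ => memLp_average hX t j

theorem memLp_fieldZ : MemLp (fieldZ X d t) p P :=
  memLp_finsetSum _ fun j _ => memLp_sub_average hX t j (t j)

end MemLp

section CovarianceRight

variable [MeasurableSpace Ω] {P : Measure Ω} [IsFiniteMeasure P] {W : Ω → ℝ}
  (hX : ∀ j t, MemLp (X j t) 2 P) (t : Fin d → unitInterval) (hW : MemLp W 2 P)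
include hX hW

theorem covariance_fieldY_right : cov[W, fieldY X d t; P] = ∑ j : Fin d, cov[W, X j (t j); P] :=
  covariance_fun_sum_right (fun j : Fin d => hX j (t j)) hW

theorem covariance_average_right (j : ℕ) :
    cov[W, fun ω => (∑ l, X j (t l) ω) / (d : ℝ); P] = (∑ l, cov[W, X j (t l); P]) / d := by
  rw [covariance_fun_div_right, covariance_fun_sum_right (fun l => hX j (t l)) hW]

theorem covariance_fieldJ_right :
    cov[W, fieldJ X d t; P] = ∑ j : Fin d, (∑ l, cov[W, X j (t l); P]) / d := by
  unfold fieldJ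
  rw [covariance_fun_sum_right (fun j : Fin d => memLp_average hX t j) hW]
  simp only [covariance_average_right hX t hW]

theorem covariance_fieldZ_right :
    cov[W, fieldZ X d t; P] =
      ∑ j : Fin d, (cov[W, X j (t j); P] - (∑ l, cov[W, X j (t l); P]) / d) := by
  unfold fieldZ
  rw [covariance_fun_sum_right (fun j : Fin d => memLp_sub_average hX t j (t j)) hW]
  refine Finset.sum_congr rfl fun j _ => ?_
  rw [← covariance_average_right hX t hW]
  exact covariance_fun_sub_right hW (hX j (t j)) (memLp_average hX t j)

end CovarianceRight

section Uncorrelated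

variable [MeasurableSpace Ω] {P : Measure Ω} [IsFiniteMeasure P]
  {𝒦 : unitInterval → unitInterval → ℝ} (hX : ∀ j t, MemLp (X j t) 2 P)
  (hcov : ∀ j k t s, cov[X j t, X k s; P] = if j = k then 𝒦 t s else 0)
  (s t : Fin d → unitInterval)
include hX hcov

theorem covariance_fieldY_left (j : Fin d) (r : unitInterval) :
    cov[fieldY X d s, X j r; P] = 𝒦 r (s j) := by
  rw [covariance_comm, covariance_fieldY_right hX s (hX j r)]
  simp only [hcov, Fin.val_inj, Finset.sum_ite_eq, Finset.mem_univ, if_true]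

theorem covariance_fieldJ_left (j : Fin d) (r : unitInterval) :
    cov[fieldJ X d s, X j r; P] = (∑ l, 𝒦 r (s l)) / d := by
  rw [covariance_comm, covariance_fieldJ_right hX s (hX j r), ← Finset.sum_div, Finset.sum_comm]
  simp only [hcov, Fin.val_inj, Finset.sum_ite_eq, Finset.mem_univ, if_true]

theorem covariance_fieldJ_fieldZ : cov[fieldJ X d s, fieldZ X d t; P] = 0 := by
  rw [covariance_fieldZ_right hX t (memLp_fieldJ hX s)]
  simp only [covariance_fieldJ_left hX hcov, Finset.sum_sub_distrib, Finset.sum_const,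
    Finset.card_univ, Fintype.card_fin, nsmul_eq_mul]
  rcases eq_or_ne d 0 with rfl | hd
  · simp only [Finset.univ_eq_empty, Finset.sum_empty, CharP.cast_eq_zero, zero_mul, sub_zero]
  · rw [mul_div_cancel₀ _ (Nat.cast_ne_zero.2 hd), sub_self]

theorem covariance_fieldZ_fieldJ : cov[fieldZ X d s, fieldJ X d t; P] = 0 := by
  rw [covariance_comm, covariance_fieldJ_fieldZ hX hcov]

theorem covFun_fieldY :
    covFun P (fieldY X d) s t = covFun P (fieldJ X d) s t + covFun P (fieldZ X d) s t := by
  have hJ := memLp_fieldJ (d := d) hX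
  have hZ := memLp_fieldZ (d := d) hX
  simp only [covFun, fieldY_eq_fieldJ_add_fieldZ, Pi.add_apply]
  rw [covariance_add_left (hJ s) (hZ s) ((hJ t).add (hZ t)),
    covariance_add_right (hJ s) (hJ t) (hZ t), covariance_add_right (hZ s) (hJ t) (hZ t),
    covariance_fieldJ_fieldZ hX hcov, covariance_fieldZ_fieldJ hX hcov, add_zero, zero_add]

theorem covFun_fieldJ :
    covFun P (fieldJ X d) s t = ∑ j, (∑ l, 𝒦 (t j) (s l)) / d := by
  have hJ := memLp_fieldJ (d := d) hX
  calc cov[fieldJ X d s, fieldJ X d t; P]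
      = cov[fieldJ X d s, fieldY X d t; P] := by
        rw [fieldY_eq_fieldJ_add_fieldZ, Pi.add_apply,
          covariance_add_right (hJ s) (hJ t) (memLp_fieldZ hX t),
          covariance_fieldJ_fieldZ hX hcov, add_zero]
    _ = ∑ j, (∑ l, 𝒦 (t j) (s l)) / d := by
        simp only [covariance_fieldY_right hX t (hJ s), covariance_fieldJ_left hX hcov]

theorem covFun_fieldZ :
    covFun P (fieldZ X d) s t = ∑ j, (𝒦 (t j) (s j) - (∑ l, 𝒦 (t l) (s j)) / d) := by
  have hZ := memLp_fieldZ (d := d) hX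
  calc cov[fieldZ X d s, fieldZ X d t; P]
      = cov[fieldY X d s, fieldZ X d t; P] := by
        rw [fieldY_eq_fieldJ_add_fieldZ, Pi.add_apply,
          covariance_add_left (memLp_fieldJ hX s) (hZ s) (hZ t),
          covariance_fieldJ_fieldZ hX hcov, zero_add]
    _ = ∑ j, (𝒦 (t j) (s j) - (∑ l, 𝒦 (t l) (s j)) / d) := by
        simp only [covariance_fieldZ_right hX t (memLp_fieldY hX s), covariance_fieldY_left hX hcov]

theorem covFun_fieldJ_comp_perm (σ : Equiv.Perm (Fin d)) :
    covFun P (fieldJ X d) s (t ∘ σ) = covFun P (fieldJ X d) s t := by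
  simp only [covFun_fieldJ hX hcov]
  exact Equiv.sum_comp σ fun j => (∑ l, 𝒦 (t j) (s l)) / d

variable (hcont : Continuous (Function.uncurry 𝒦))
include hcont

theorem continuous_covFun_fieldJ : Continuous (Function.uncurry (covFun P (fieldJ X d))) := by
  have h : Function.uncurry (covFun P (fieldJ X d)) =
      fun p => ∑ j, (∑ l, 𝒦 (p.2 j) (p.1 l)) / d :=
    funext fun p => covFun_fieldJ hX hcov p.1 p.2
  rw [h]
  fun_prop

theorem continuous_covFun_fieldZ : Continuous (Function.uncurry (covFun P (fieldZ X d))) := by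
  have h : Function.uncurry (covFun P (fieldZ X d)) =
      fun p => ∑ j, (𝒦 (p.2 j) (p.1 j) - (∑ l, 𝒦 (p.2 l) (p.1 j)) / d) :=
    funext fun p => covFun_fieldZ hX hcov p.1 p.2
  rw [h]
  fun_prop

theorem continuous_covFun_fieldY : Continuous (Function.uncurry (covFun P (fieldY X d))) := by
  have h : Function.uncurry (covFun P (fieldY X d)) =
      Function.uncurry (covFun P (fieldJ X d)) + Function.uncurry (covFun P (fieldZ X d)) :=
    funext fun p => covFun_fieldY hX hcov p.1 p.2
  rw [h]
  exact (continuous_covFun_fieldJ hX hcov hcont).add (continuous_covFun_fieldZ hX hcov hcont)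

theorem integral_covFun_fieldZ_mul_covFun_fieldJ :
    ∫ u, covFun P (fieldZ X d) s u * covFun P (fieldJ X d) t u = 0 := by
  have hJ : Continuous fun u => covFun P (fieldJ X d) t u :=
    (continuous_covFun_fieldJ hX hcov hcont).comp (.prodMk_right t)
  simp only [covFun_fieldZ hX hcov, Finset.sum_mul]
  rw [integral_finsetSum _ fun j _ => integrable_of_continuous_of_compactSpace (by fun_prop)]
  refine Finset.sum_eq_zero fun j _ => ?_
  simpa only [Fintype.card_fin] using integral_eval_sub_average_mul_eq_zero_of_symmetric
    (f := fun r => 𝒦 r (s j)) (fun σ u => covFun_fieldJ_comp_perm hX hcov t u σ)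
    (fun i => integrable_of_continuous_of_compactSpace (by fun_prop)) j

theorem covEnd_fieldJ_mul_covEnd_fieldZ :
    covEnd (d := d) (continuous_covFun_fieldJ hX hcov hcont) *
      covEnd (continuous_covFun_fieldZ hX hcov hcont) = 0 :=
  kernelOp_mul_eq_zero (fun _ _ => covariance_comm _ _)
    fun s t => integral_covFun_fieldZ_mul_covFun_fieldJ hX hcov s t hcont

theorem covEnd_fieldY :
    covEnd (d := d) (continuous_covFun_fieldY hX hcov hcont) =
      covEnd (continuous_covFun_fieldJ hX hcov hcont) +
        covEnd (continuous_covFun_fieldZ hX hcov hcont) := by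
  rw [covEnd, covEnd, covEnd, ← kernelOp_add]
  congr 1
  ext p
  exact covFun_fieldY hX hcov p.1 p.2

end Uncorrelated

end Fields

theorem proposition3_general {Ω : Type*} [MeasurableSpace Ω] (P : Measure Ω) [IsFiniteMeasure P]
    (X : ℕ → unitInterval → Ω → ℝ) (𝒦 : unitInterval → unitInterval → ℝ)
    (hL2 : ∀ j t, MemLp (X j t) 2 P) (hcont : Continuous (Function.uncurry 𝒦))
    (hcov : ∀ j t s, cov[X j t, X j s; P] = 𝒦 t s)
    (huncorr : ∀ j k, j ≠ k → ∀ t s, cov[X j t, X k s; P] = 0)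
    (d : ℕ) (SJ SZ : Set (ℝ × L2Cube d))
    (hSJ : IsEigenpairSet P (fieldJ X d) SJ) (hSZ : IsEigenpairSet P (fieldZ X d) SZ) :
    SJ ∩ SZ = ∅ ∧ IsEigenpairSet P (fieldY X d) (SJ ∪ SZ) := by
  have hcov' (j k : ℕ) (t s : unitInterval) :
      cov[X j t, X k s; P] = if j = k then 𝒦 t s else 0 := by
    split_ifs with h
    · rw [← h, hcov]
    · exact huncorr j k h t s
  have mul_eq_zero := covEnd_fieldJ_mul_covEnd_fieldZ (d := d) hL2 hcov' hcont
  obtain ⟨hJ, hJpos⟩ := (isEigenpairSet_iff (continuous_covFun_fieldJ hL2 hcov' hcont)).1 hSJ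
  obtain ⟨hZ, hZpos⟩ := (isEigenpairSet_iff (continuous_covFun_fieldZ hL2 hcov' hcont)).1 hSZ
  refine ⟨(hJ.disjoint_of_mul_eq_zero mul_eq_zero hZ).inter_eq,
    (isEigenpairSet_iff (continuous_covFun_fieldY hL2 hcov' hcont)).2
      ⟨?_, fun p => Or.rec (hJpos p) (hZpos p)⟩⟩
  rw [covEnd_fieldY hL2 hcov' hcont]
  exact hJ.union (isSymmetric_covEnd _) (isSymmetric_covEnd _) mul_eq_zero hZ

theorem proposition3 {Ω : Type*} [MeasurableSpace Ω] (P : Measure Ω) [IsProbabilityMeasure P]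
    (X : ℕ → unitInterval → Ω → ℝ) (𝒦 : unitInterval → unitInterval → ℝ)
    (hL2 : ∀ j t, MemLp (X j t) 2 P)
    (hmean : ∀ j t, ∫ ω, X j t ω ∂P = 0)
    (hcont : Continuous (Function.uncurry 𝒦))
    (hcov : ∀ j t s, cov[X j t, X j s; P] = 𝒦 t s)
    (huncorr : ∀ j k, j ≠ k → ∀ t s, cov[X j t, X k s; P] = 0)
    (d : ℕ) (hd : 1 ≤ d)
    (SJ SZ : Set (ℝ × L2Cube d))
    (hSJ : IsEigenpairSet P (fieldJ X d) SJ) (hSZ : IsEigenpairSet P (fieldZ X d) SZ) :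
    SJ ∩ SZ = ∅ ∧ IsEigenpairSet P (fieldY X d) (SJ ∪ SZ) :=
  proposition3_general P X 𝒦 hL2 hcont hcov huncorr d SJ SZ hSJ hSZ
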